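/- Let $X$ be a real Banach space with closed unit ball $B_X$ and bidual $X^{**}$ (with $X$ identified with its canonical image in $X^{**}$). For $\varepsilon\ge 0$, a bounded set $M\subseteq X$ is called $\varepsilon$-weakly relatively compact if $\overline{M}^{w^*}\subseteq X+\varepsilon B_{X^{**}}$, where the closure is taken in the weak-star topology of $X^{**}$. The space $X$ has property $(*)$ if there is a countable family $\{M_{n,p}: n,p\in\mathbb{N}\}$ of subsets of $X$ ($p \geq 1$) such that (i) for all $n,p$ the set $M_{n,p}$ is $\frac1p$-weakly relatively compact; (ii) for every $p$ and every weakly compact $L\subseteq X$ there is $n$ with $L\subseteq M_{n,p}$. If $Z$ is a Banach space containing $X$ as a closed linear subspace (up to a linear isometric embedding), then $X$ is called SWCG (strongly weakly compactly generated) with respect to $Z$ if there is a weakly compact set $K\subseteq Z$ such that for every $\varepsilon>0$ and every weakly compact $L\subseteq X$ there is an integer $n\ge 1$ with $L\subseteq nK+\varepsilon B_Z$. **Theorem.** Every real Banach space $X$ with property $(*)$ is weakly sequentially complete, that is, every weakly Cauchy sequence in $X$ converges weakly to an element of $X$. In particular, every Banach space $X$ that is SWCG with respect to some Banach space $Z\supseteq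 X$ is weakly sequentially complete. -/

import Mathlib

open Filter Topology
open scoped Pointwise

section WeakBanach

variable {X : Type*} [NormedAddCommGroup X] [NormedSpace ℝ X]

/-- A set `L` is weakly compact if it is compact in the weak topology of `X`. -/
def IsWeaklyCompact (L : Set X) : Prop :=
  IsCompact (toWeakSpace ℝ X '' L)

/-- `M` is `ε`-weakly relatively compact: it is bounded and its weak-star closure in the bidual
`X**` is contained in `X + ε B_{X**}`, where `X` is identified with its canonical image. -/
def IsEpsWeaklyRelCompact (ε : ℝ) (M : Set X) : Prop :=
  Bornology.IsBounded M ∧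
    closure ((fun x : X ↦ StrongDual.toWeakDual (NormedSpace.inclusionInDoubleDual ℝ X x)) '' M) ⊆
      StrongDual.toWeakDual ''
        (Set.range (NormedSpace.inclusionInDoubleDual ℝ X) +
          ε • Metric.closedBall (0 : StrongDual ℝ (StrongDual ℝ X)) 1)

variable (X) in
/-- Property (*): there are sets `M n p` (`p ≥ 1`) such that every `M n p` is
`1/p`-weakly relatively compact and, for each `p`, every weakly compact set lies in
some `M n p`. -/
def HasPropertyStar : Prop :=
  ∃ M : ℕ → ℕ → Set X,
    (∀ n p : ℕ, 1 ≤ p → IsEpsWeaklyRelCompact (1 / (p : ℝ)) (M n p)) ∧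
    ∀ p : ℕ, 1 ≤ p → ∀ L : Set X, IsWeaklyCompact L → ∃ n : ℕ, L ⊆ M n p

/-- A sequence is weakly Cauchy if every continuous linear functional maps it to a Cauchy
sequence of scalars. -/
def IsWeaklyCauchySeq (x : ℕ → X) : Prop :=
  ∀ f : StrongDual ℝ X, CauchySeq fun n ↦ f (x n)

variable (X) in
/-- `X` is weakly sequentially complete: every weakly Cauchy sequence converges weakly. -/
def IsWeaklySeqComplete : Prop :=
  ∀ x : ℕ → X, IsWeaklyCauchySeq x →
    ∃ a : X, Tendsto (fun n ↦ toWeakSpace ℝ X (x n)) atTop (𝓝 (toWeakSpace ℝ X a))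

/-- `X` is strongly weakly compactly generated (SWCG) with respect to the superspace `Z`, where
the inclusion of `X` in `Z` is the linear isometry `ι`. -/
def IsSWCGWithRespectTo {Z : Type*} [NormedAddCommGroup Z] [NormedSpace ℝ Z]
    (ι : X →ₗᵢ[ℝ] Z) : Prop :=
  ∃ K : Set Z, IsWeaklyCompact K ∧
    ∀ ε : ℝ, 0 < ε → ∀ L : Set X, IsWeaklyCompact L →
      ∃ n : ℕ, 1 ≤ n ∧ ι '' L ⊆ (n : ℝ) • K + ε • Metric.closedBall (0 : Z) 1

end WeakBanach

section WeakBanach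

open NormedSpace

variable {X Z : Type*} [NormedAddCommGroup X] [NormedSpace ℝ X]
  [NormedAddCommGroup Z] [NormedSpace ℝ Z]

/-! Both claims reduce to `isWeaklySeqComplete_of_countable_capture`, a diagonal argument. Let `φ ∈
Z**` be the weak-star limit of a weakly Cauchy `x`. If `φ ∉ Z`, then `φ ∉ Z + ε B` for some `ε > 0`,
as `Z` is closed in `Z**`. For fixed `k`, `x m - x k` tends to `φ - x k ∉ Z + ε B`, so it eventually
leaves each `N j`. Choosing `m k ≥ k` with `x (m k) - x k` outside `N 0, …, N k` gives a weakly null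
sequence that no single `N j` captures. -/

lemma tendsto_toWeakSpace_iff {x : ℕ → X} {a : X} :
    Tendsto (fun n ↦ toWeakSpace ℝ X (x n)) atTop (𝓝 (toWeakSpace ℝ X a)) ↔
      ∀ f : StrongDual ℝ X, Tendsto (fun n ↦ f (x n)) atTop (𝓝 (f a)) :=
  WeakBilin.tendsto_iff_forall_eval_tendsto _
    (fun _ _ h ↦ (SeparatingDual.eq_iff_forall_dual_eq (R := ℝ)).2 fun f ↦ LinearMap.congr_fun h f)

lemma tendsto_toWeakDual_iff {u : ℕ → StrongDual ℝ X} {a : StrongDual ℝ X} :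
    Tendsto (fun n ↦ StrongDual.toWeakDual (u n)) atTop (𝓝 (StrongDual.toWeakDual a)) ↔
      ∀ x : X, Tendsto (fun n ↦ u n x) atTop (𝓝 (a x)) :=
  tendsto_iff_forall_eval_tendsto_topDualPairing

/-- A weakly Cauchy sequence converges weak-star in the bidual. -/
lemma IsWeaklyCauchySeq.exists_bidual_limit {x : ℕ → X} (hx : IsWeaklyCauchySeq x) :
    ∃ φ : StrongDual ℝ (StrongDual ℝ X),
      ∀ f : StrongDual ℝ X, Tendsto (fun n ↦ f (x n)) atTop (𝓝 (φ f)) := by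
  choose l hl using fun f ↦ cauchySeq_tendsto_of_complete (hx f)
  -- Banach–Steinhaus on the complete space `X*` makes the pointwise limit bounded.
  exact ⟨continuousLinearMapOfTendsto (fun n ↦ inclusionInDoubleDual ℝ X (x n))
    (tendsto_pi_nhds.2 hl), hl⟩

lemma IsWeaklyCauchySeq.map {x : ℕ → X} (hx : IsWeaklyCauchySeq x) (T : X →L[ℝ] Z) :
    IsWeaklyCauchySeq fun n ↦ T (x n) :=
  fun f ↦ hx (f.comp T)

/-- A linear isometry from a Banach space reflects weak convergence. -/
lemma LinearIsometry.exists_tendsto_toWeakSpace [CompleteSpace X] (ι : X →ₗᵢ[ℝ] Z)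
    {x : ℕ → X} {z : Z}
    (h : Tendsto (fun n ↦ toWeakSpace ℝ Z (ι (x n))) atTop (𝓝 (toWeakSpace ℝ Z z))) :
    ∃ a : X, Tendsto (fun n ↦ toWeakSpace ℝ X (x n)) atTop (𝓝 (toWeakSpace ℝ X a)) := by
  have hz : toWeakSpace ℝ Z z ∈ closure (toWeakSpace ℝ Z '' Set.range ι) :=
    mem_closure_of_tendsto h (Eventually.of_forall fun n ↦ ⟨_, ⟨x n, rfl⟩, rfl⟩)
  have hconv : Convex ℝ (Set.range ι) :=
    (LinearMap.range ι.toLinearMap).convex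
  -- Mazur: the range of `ι` is convex and norm closed, hence weakly closed.
  rw [← hconv.toWeakSpace_closure ℝ,
    ι.isometry.isClosedEmbedding.isClosed_range.closure_eq] at hz
  obtain ⟨_, ⟨a, rfl⟩, ha⟩ := hz
  obtain rfl := (toWeakSpace ℝ Z).injective ha
  refine ⟨a, tendsto_toWeakSpace_iff.2 fun f ↦ ?_⟩
  obtain ⟨g, hg, -⟩ := exists_extension_norm_eq (LinearMap.range ι.toLinearMap)
    (f.comp (ι.equivRange.symm : _ →L[ℝ] X))
  have key (y : X) : g (ι y) = f y := by
    have := hg (ι.equivRange y)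
    simpa using this
  simpa only [key] using tendsto_toWeakSpace_iff.1 h g

lemma StrongDual.mem_unitClosedBall_iff {f : StrongDual ℝ X} :
    f ∈ Metric.closedBall (0 : StrongDual ℝ X) 1 ↔ ‖f‖ ≤ 1 :=
  mem_closedBall_zero_iff

lemma LinearIsometry.isClosed_range_strongDual [CompleteSpace Z] (T : Z →ₗᵢ[ℝ] StrongDual ℝ X) :
    IsClosed (Set.range T) :=
  T.isometry.isClosedEmbedding.isClosed_range

lemma StrongDual.mem_of_forall_mem_add_smul_closedBall {S : Set (StrongDual ℝ X)}
    (hS : IsClosed S) {φ : StrongDual ℝ X}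
    (h : ∀ ε : ℝ, 0 < ε → φ ∈ S + ε • Metric.closedBall (0 : StrongDual ℝ X) 1) : φ ∈ S := by
  rw [← hS.closure_eq, Metric.mem_closure_iff]
  intro ε hε
  obtain ⟨y, hy, w, ⟨v, hv, rfl⟩, rfl⟩ := h (ε / 2) (by positivity)
  refine ⟨y, hy, ?_⟩
  have hv' : ‖v‖ ≤ 1 := by simpa using hv
  simp only [dist_eq_norm, add_sub_cancel_left, norm_smul, Real.norm_eq_abs,
    abs_of_pos (half_pos hε)]
  nlinarith

lemma StrongDual.smul_unitClosedBall_mono {δ ε : ℝ} (hδ : 0 ≤ δ) (h : δ ≤ ε) :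
    δ • Metric.closedBall (0 : StrongDual ℝ X) 1 ⊆
      ε • Metric.closedBall (0 : StrongDual ℝ X) 1 := by
  rw [smul_unitClosedBall, smul_unitClosedBall, Real.norm_of_nonneg hδ,
    Real.norm_of_nonneg (hδ.trans h)]
  exact Metric.closedBall_subset_closedBall h

lemma isWeaklyCompact_insert_range {u : ℕ → X} {a : X}
    (h : ∀ f : StrongDual ℝ X, Tendsto (fun n ↦ f (u n)) atTop (𝓝 (f a))) :
    IsWeaklyCompact (insert a (Set.range u)) := by
  have := (tendsto_toWeakSpace_iff.2 h).isCompact_insert_range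
  rwa [IsWeaklyCompact, Set.image_insert_eq, ← Set.range_comp]

/-- If, for each `ε > 0`, the weakly compact subsets of `X` are captured by countably many subsets
of `Z ⊇ X` whose weak-star closures lie in `Z + ε B_{Z**}`, then `X` is weakly sequentially
complete. -/
theorem isWeaklySeqComplete_of_countable_capture [CompleteSpace X] [CompleteSpace Z]
    (ι : X →ₗᵢ[ℝ] Z)
    (h : ∀ ε : ℝ, 0 < ε → ∃ N : ℕ → Set Z,
      (∀ j, closure ((fun z : Z ↦ StrongDual.toWeakDual (inclusionInDoubleDual ℝ Z z)) '' N j) ⊆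
        StrongDual.toWeakDual '' (Set.range (inclusionInDoubleDual ℝ Z) +
          ε • Metric.closedBall (0 : StrongDual ℝ (StrongDual ℝ Z)) 1)) ∧
      ∀ L : Set X, IsWeaklyCompact L → ∃ j, ι '' L ⊆ N j) :
    IsWeaklySeqComplete X := by
  intro x hx
  obtain ⟨φ, hφ⟩ := (hx.map ι.toContinuousLinearMap).exists_bidual_limit
  suffices hmem : φ ∈ Set.range (inclusionInDoubleDual ℝ Z) by
    obtain ⟨z, rfl⟩ := hmem
    exact ι.exists_tendsto_toWeakSpace (tendsto_toWeakSpace_iff.2 hφ)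
  refine StrongDual.mem_of_forall_mem_add_smul_closedBall
    (inclusionInDoubleDualLi (E := Z) ℝ).isClosed_range_strongDual fun ε hε ↦ ?_
  obtain ⟨N, hN, hL⟩ := h ε hε
  by_contra hnot
  have hfin (k j : ℕ) : ∀ᶠ m in atTop, ι (x m - x k) ∉ N j := by
    by_contra hfreq
    have hfreq : ∃ᶠ m in atTop, ι (x m - x k) ∈ N j := by
      simpa [Filter.Frequently] using hfreq
    have hlim : Tendsto (fun m ↦ StrongDual.toWeakDual
        (inclusionInDoubleDual ℝ Z (ι (x m - x k)))) atTop
        (𝓝 (StrongDual.toWeakDual (φ - inclusionInDoubleDual ℝ Z (ι (x k))))) := by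
      refine tendsto_toWeakDual_iff.2 fun f ↦ ?_
      simpa using (hφ f).sub_const (f (ι (x k)))
    obtain ⟨ψ, ⟨_, ⟨y, rfl⟩, w, hw, rfl⟩, hψ⟩ := hN j <|
      mem_closure_of_frequently_of_tendsto (hfreq.mono fun m hm ↦ Set.mem_image_of_mem _ hm) hlim
    have hψ : inclusionInDoubleDual ℝ Z y + w = φ - inclusionInDoubleDual ℝ Z (ι (x k)) :=
      StrongDual.toWeakDual.injective hψ
    -- `Z + ε B` is invariant under translation by `ι (x k) ∈ Z`.
    refine hnot ⟨_, ⟨y + ι (x k), rfl⟩, w, hw, ?_⟩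
    change inclusionInDoubleDual ℝ Z (y + ι (x k)) + w = φ
    rw [map_add, add_right_comm, hψ, sub_add_cancel]
  have hsel (k : ℕ) : ∃ m, k ≤ m ∧ ∀ j ≤ k, ι (x m - x k) ∉ N j :=
    ((eventually_ge_atTop k).and
      ((Set.finite_Iic k).eventually_all.2 fun j _ ↦ hfin k j)).exists
  choose m hkm hm using hsel
  have hcpt : IsWeaklyCompact (insert 0 (Set.range fun k ↦ x (m k) - x k)) := by
    refine isWeaklyCompact_insert_range fun f ↦ ?_
    obtain ⟨l, hl⟩ := cauchySeq_tendsto_of_complete (hx f)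
    simpa using (hl.comp (tendsto_atTop_mono hkm tendsto_id)).sub hl
  obtain ⟨j, hj⟩ := hL _ hcpt
  -- The diagonal term `k = j` avoids `N j` by choice.
  exact hm j j le_rfl (hj ⟨_, Set.mem_insert_of_mem _ ⟨j, rfl⟩, rfl⟩)

theorem HasPropertyStar.isWeaklySeqComplete [CompleteSpace X] (h : HasPropertyStar X) :
    IsWeaklySeqComplete X := by
  obtain ⟨M, hM, hL⟩ := h
  refine isWeaklySeqComplete_of_countable_capture (LinearIsometry.id : X →ₗᵢ[ℝ] X) fun ε hε ↦ ?_
  obtain ⟨p, hp⟩ := exists_nat_one_div_lt hε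
  refine ⟨fun j ↦ M j (p + 1), fun j ↦ ((hM j (p + 1) (by simp)).2).trans ?_,
    fun L h ↦ by simpa using hL (p + 1) (by simp) L h⟩
  refine Set.image_mono (Set.add_subset_add_left
    (StrongDual.smul_unitClosedBall_mono (by positivity) ?_))
  exact_mod_cast hp.le

/-- The weak-star closure of `r K + ε B_Z`, with `K` weakly compact, lies in `Z + ε B_{Z**}`. -/
lemma IsWeaklyCompact.closure_smul_add_subset {K : Set Z} (hK : IsWeaklyCompact K) (r ε : ℝ) :
    closure ((fun z : Z ↦ StrongDual.toWeakDual (inclusionInDoubleDual ℝ Z z)) ''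
        (r • K + ε • Metric.closedBall (0 : Z) 1)) ⊆
      StrongDual.toWeakDual '' (Set.range (inclusionInDoubleDual ℝ Z) +
        ε • Metric.closedBall (0 : StrongDual ℝ (StrongDual ℝ Z)) 1) := by
  set J : Z →ₗ[ℝ] WeakDual ℝ (StrongDual ℝ Z) :=
    StrongDual.toWeakDual.toLinearMap ∘ₗ (inclusionInDoubleDual ℝ Z).toLinearMap with hJ
  have hJK : IsCompact (J '' K) := by
    have := hK.image (inclusionInDoubleDualWeak ℝ Z).continuous
    rwa [Set.image_image] at this
  have hB : IsCompact (WeakDual.toStrongDual ⁻¹'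
      Metric.closedBall (0 : StrongDual ℝ (StrongDual ℝ Z)) 1) :=
    WeakDual.isCompact_closedBall 0 1
  -- By Banach–Alaoglu, `r K + ε B_{Z**}` is a sum of weak-star compact sets, hence closed.
  refine (closure_minimal ?_ ((hJK.smul r).add (hB.smul ε)).isClosed).trans ?_
  · rintro _ ⟨_, ⟨_, ⟨a, ha, rfl⟩, _, ⟨b, hb, rfl⟩, rfl⟩, rfl⟩
    refine ⟨r • J a, ⟨J a, ⟨a, ha, rfl⟩, rfl⟩, ε • J b, ⟨J b, ?_, rfl⟩, ?_⟩
    · have hb' : ‖b‖ ≤ 1 := by simpa using hb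
      have : ‖inclusionInDoubleDual ℝ Z b‖ ≤ 1 := (double_dual_bound ℝ Z b).trans hb'
      exact StrongDual.mem_unitClosedBall_iff.2 this
    · simp [hJ]
  · rintro _ ⟨_, ⟨_, ⟨a, ha, rfl⟩, rfl⟩, _, ⟨b, hb, rfl⟩, rfl⟩
    exact ⟨_, ⟨_, ⟨r • a, rfl⟩, _, ⟨WeakDual.toStrongDual b, hb, rfl⟩, rfl⟩, by simp [hJ]⟩

theorem IsSWCGWithRespectTo.isWeaklySeqComplete [CompleteSpace X] [CompleteSpace Z]
    {ι : X →ₗᵢ[ℝ] Z} (h : IsSWCGWithRespectTo ι) : IsWeaklySeqComplete X := by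
  obtain ⟨K, hK, hL⟩ := h
  refine isWeaklySeqComplete_of_countable_capture ι fun ε hε ↦
    ⟨fun n ↦ (n : ℝ) • K + ε • Metric.closedBall (0 : Z) 1,
      fun n ↦ hK.closure_smul_add_subset n ε, fun L h ↦ ?_⟩
  obtain ⟨n, -, hn⟩ := hL ε hε L h
  exact ⟨n, hn⟩

end WeakBanach

theorem mainTheorem5 (X : Type*) [NormedAddCommGroup X] [NormedSpace ℝ X]
    [CompleteSpace X] :
    (HasPropertyStar X → IsWeaklySeqComplete X) ∧
      (∀ (Z : Type*) [NormedAddCommGroup Z] [NormedSpace ℝ Z] [CompleteSpace Z]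
        (ι : X →ₗᵢ[ℝ] Z), IsSWCGWithRespectTo ι → IsWeaklySeqComplete X) :=
  ⟨fun h ↦ h.isWeaklySeqComplete, fun _ _ _ _ _ h ↦ h.isWeaklySeqComplete⟩
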